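/- Let $X,Y$ be real Hilbert spaces, let $f:X\to\mathbb{R}\cup\{\pm\infty\}$ and $g:Y\to\mathbb{R}\cup\{\pm\infty\}$ be proper, convex and lower semicontinuous, and let $K:X\to Y$ be linear and continuous with adjoint $K^*$. Write $\operatorname{dom} f=\{x: f(x)<+\infty\}$, $f^*(u)=\sup_{x\in X}\{\langle u,x\rangle-f(x)\}$, $\partial f(x)=\{u: f(z)\ge f(x)+\langle u,z-x\rangle\ \forall z\in X\}$ if $f(x)\in\mathbb{R}$ and $\partial f(x)=\emptyset$ otherwise, and, for $\gamma>0$, let $\operatorname{prox}_{\gamma f}(x)$ be the unique minimizer of $z\mapsto f(z)+\frac1{2\gamma}\|z-x\|^2$ (similarly on $Y$). For a convex set $C\subseteq Y$ let $\operatorname{sqri} C$ be the set of those $c\in C$ for which $\bigcup_{\lambda>0}\lambda(C-c)$ is a closed linear subspace of $Y$. Consider the primal problem $$\inf_{x\in X}\{f(x)+g(Kx)\}\qquad (P)$$ and its Fenchel dual $$\sup_{y\in Y}\{-f^*(-K^*y)-g^*(y)\}.\qquad (D)$$ Assume that $(P)$ has an optimal solution $\hat x$ and that one of the following qualification conditions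 holds: $(QC_1)$ there is $x'\in\operatorname{dom} f\cap K^{-1}(\operatorname{dom} g)$ such that $g$ is continuous at $Kx'$; $(QC_2)$ $0\in\operatorname{int}(\operatorname{dom} g-K(\operatorname{dom} f))$; $(QC_3)$ $0\in\operatorname{sqri}(\operatorname{dom} g-K(\operatorname{dom} f))$. Then the following statements are true. (i) There exists an optimal solution $\hat y\in Y$ of $(D)$, the optimal objective values of $(P)$ and $(D)$ coincide, and $$K\hat x\in\partial g^*(\hat y)\quad\text{and}\quad -K^*\hat y\in\partial f(\hat x).$$ Moreover, let $\sigma,\tau>0$ with $\sigma\tau\|K\|^2<1$ and $(x^0,y^0)\in X\times Y$ be arbitrary, put $\bar x^0:=x^0$, and for $n\ge 0$ let $$y^{n+1}:=\operatorname{prox}_{\sigma g^*}(y^n+\sigma K\bar x^n),\qquad x^{n+1}:=\operatorname{prox}_{\tau f}(x^n-\tau K^*y^{n+1}),\qquad \bar x^{n+1}:=2x^{n+1}-x^n.$$ (ii) For every optimal solution $\hat y$ of $(D)$ and every $n\ge0$, $$\frac{\|x^n-\hat x\|^2}{2\tau}+(1-\sigma\tau\|K\|^2)\frac{\|y^n-\hat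 y\|^2}{2\sigma}\le\frac{\|x^0-\hat x\|^2}{2\tau}+\frac{\|y^0-\hat y\|^2}{2\sigma};$$ in particular, the sequence $(x^n,y^n)_{n\ge0}$ is bounded. (iii) If $X$ and $Y$ are finite-dimensional, then $(x^n)_{n\ge0}$ converges to an optimal solution of $(P)$ and $(y^n)_{n\ge0}$ converges to an optimal solution of $(D)$. -/

import Mathlib

open scoped Pointwise

namespace ConvexDuality

noncomputable section

variable {X : Type*} [NormedAddCommGroup X] [InnerProductSpace ℝ X]
variable {Y : Type*} [NormedAddCommGroup Y] [InnerProductSpace ℝ Y]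

/-- The effective domain of an extended real valued function. -/
def effDom (f : X → EReal) : Set X := {x | f x < ⊤}

/-- Proper, convex (the epigraph is a convex set) and lower semicontinuous functions. -/
structure ProperConvexLsc (f : X → EReal) : Prop where
  dom_nonempty : (effDom f).Nonempty
  ne_bot : ∀ x, f x ≠ ⊥
  convex_epigraph : Convex ℝ {p : X × ℝ | f p.1 ≤ (p.2 : EReal)}
  lsc : LowerSemicontinuous f

/-- The conjugate `f*(u) = sup_x {⟨u, x⟩ - f x}`. -/
def conj (f : X → EReal) (u : X) : EReal := ⨆ x : X, (((inner ℝ u x : ℝ) : EReal) - f x)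

/-- The convex subdifferential, empty at the points where `f` is not finite. -/
def subdiff (f : X → EReal) (x : X) : Set X :=
  {u | f x ≠ ⊤ ∧ f x ≠ ⊥ ∧ ∀ z : X, f x + ((inner ℝ u (z - x) : ℝ) : EReal) ≤ f z}

/-- The strong quasi-relative interior: the points `x ∈ C` for which the cone
`⋃_{t > 0} t (C - x)` is a closed linear subspace. -/
def sqri (C : Set X) : Set X :=
  {x | x ∈ C ∧ ∃ V : Submodule ℝ X, IsClosed (V : Set X) ∧
    (⋃ t ∈ Set.Ioi (0 : ℝ), t • (C - {x})) = (V : Set X)}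

/-- `p` is the proximal point of parameter `γ` of `f` at `x`, i.e. it minimizes
`z ↦ f z + ‖z - x‖² / (2γ)`. -/
def IsProx (γ : ℝ) (f : X → EReal) (x p : X) : Prop :=
  ∀ z : X, f p + ((‖p - x‖ ^ 2 / (2 * γ) : ℝ) : EReal) ≤
    f z + ((‖z - x‖ ^ 2 / (2 * γ) : ℝ) : EReal)

/-- The primal objective `x ↦ f x + g (K x)`. -/
def primalObj (f : X → EReal) (g : Y → EReal) (K : X →L[ℝ] Y) (x : X) : EReal :=
  f x + g (K x)

/-- The objective `y ↦ -f*(-K* y) - g*(y)` of the Fenchel dual. -/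
def dualObj [CompleteSpace X] [CompleteSpace Y]
    (f : X → EReal) (g : Y → EReal) (K : X →L[ℝ] Y) (y : Y) : EReal :=
  -conj f (-(ContinuousLinearMap.adjoint K y)) - conj g y

/-- `x` is an optimal solution of the primal problem. -/
def IsPrimalOptimal (f : X → EReal) (g : Y → EReal) (K : X →L[ℝ] Y) (x : X) : Prop :=
  ∀ z : X, primalObj f g K x ≤ primalObj f g K z

/-- `y` is an optimal solution of the Fenchel dual problem. -/
def IsDualOptimal [CompleteSpace X] [CompleteSpace Y]
    (f : X → EReal) (g : Y → EReal) (K : X →L[ℝ] Y) (y : Y) : Prop :=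
  ∀ z : Y, dualObj f g K z ≤ dualObj f g K y

/-- `g` is continuous at some point `K x'` with `x' ∈ dom f ∩ K⁻¹(dom g)`. -/
def QC1 (f : X → EReal) (g : Y → EReal) (K : X →L[ℝ] Y) : Prop :=
  ∃ x' : X, x' ∈ effDom f ∩ K ⁻¹' effDom g ∧ ContinuousAt g (K x')

/-- `0 ∈ int (dom g - K (dom f))`. -/
def QC2 (f : X → EReal) (g : Y → EReal) (K : X →L[ℝ] Y) : Prop :=
  (0 : Y) ∈ interior (effDom g - K '' effDom f)

/-- `0 ∈ sqri (dom g - K (dom f))`. -/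
def QC3 (f : X → EReal) (g : Y → EReal) (K : X →L[ℝ] Y) : Prop :=
  (0 : Y) ∈ sqri (effDom g - K '' effDom f)

/-- The sequence `(xⁿ, x̄ⁿ, yⁿ)` is generated by the primal-dual algorithm with step
sizes `σ` (dual) and `τ` (primal), from the starting point `(x⁰, y⁰)`. -/
structure IsPrimalDualSeq [CompleteSpace X] [CompleteSpace Y]
    (f : X → EReal) (g : Y → EReal) (K : X →L[ℝ] Y) (σ τ : ℝ)
    (x xbar : ℕ → X) (y : ℕ → Y) : Prop where
  init : xbar 0 = x 0
  step_y : ∀ n, IsProx σ (conj g) (y n + σ • K (xbar n)) (y (n + 1))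
  step_x : ∀ n, IsProx τ f (x n - τ • ContinuousLinearMap.adjoint K (y (n + 1))) (x (n + 1))
  step_xbar : ∀ n, xbar (n + 1) = (2 : ℝ) • x (n + 1) - x n

end

end ConvexDuality

/-! Everything rests on saddle points: pairs with `-K* y ∈ ∂f(x)` and `y ∈ ∂g(K x)`. Such a pair has
equality in both Fenchel–Young inequalities, so weak duality makes both points optimal with equal
values.

Existence (`exists_isSaddle`): the qualification conditions reduce to `QC3`, where the cone of `dom
g - K (dom f)` is a closed subspace `V`. A Baire argument (`exists_image_mem_nhds_of_absorbing`)
bounds the perturbation function above near `0` in `V`, so the convex set of pairs `(z - K x, a +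
b)` lying over the epigraphs has an interior point over `0`. Separating its lowest possible point
over `0` gives a non-vertical hyperplane, whose slope is the dual solution (`exists_multiplier`).

Algorithm: proximal steps are subgradient inclusions, and monotonicity against a saddle point makes
`energy` nonincreasing (`energy_step`); its lower bound gives the estimate and boundedness. Since `σ
τ ‖K‖² < 1` strictly, the decrease also controls the increments, which tend to zero. In finite
dimensions a cluster point is then a saddle point, and the energy centred there tends to zero along
a subsequence, hence along the whole sequence. -/

namespace ConvexDuality

open Filter Topology

/-! ### Open mapping principle for bounded closed convex sets. -/

section OpenMapping

variable {E F : Type*} [NormedAddCommGroup E] [NormedSpace ℝ E]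
  [NormedAddCommGroup F] [NormedSpace ℝ F]

/-- A closed convex bounded set contains the dyadic series of its elements. -/
lemma tsum_dyadic_mem {B : Set E} (hc : Convex ℝ B) (hcl : IsClosed B) {b : ℕ → E}
    (hb : ∀ n, b n ∈ B) (hs : Summable fun n => ((1 : ℝ) / 2) ^ (n + 1) • b n) :
    ∑' n, ((1 : ℝ) / 2) ^ (n + 1) • b n ∈ B := by
  -- The weights of a partial sum miss `1` by `2⁻ⁿ`; placing that mass on `b 0` gives a convex
  -- combination.
  have key : ∀ n, (∑ i ∈ Finset.range n, ((1 : ℝ) / 2) ^ (i + 1) • b i)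
      + ((1 : ℝ) / 2) ^ n • b 0 ∈ B := by
    have aux : ∀ n, ∀ c ∈ B, (∑ i ∈ Finset.range n, ((1 : ℝ) / 2) ^ (i + 1) • b i)
      + ((1 : ℝ) / 2) ^ n • c ∈ B := by
      intro n
      induction n with
      | zero => intro c hc; simpa using hc
      | succ n ih =>
        intro c hcB
        have h := ih _ (hc (hb n) hcB (a := 1 / 2) (b := 1 / 2) (by norm_num) (by norm_num)
          (by norm_num))
        convert h using 1
        rw [Finset.sum_range_succ, smul_add, smul_smul, smul_smul, ← pow_succ, add_assoc]
    exact fun n => aux n _ (hb 0)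
  have h1 : Tendsto (fun n => (∑ i ∈ Finset.range n, ((1 : ℝ) / 2) ^ (i + 1) • b i)
      + ((1 : ℝ) / 2) ^ n • b 0) atTop
      (𝓝 ((∑' n, ((1 : ℝ) / 2) ^ (n + 1) • b n) + (0 : ℝ) • b 0)) :=
    hs.hasSum.tendsto_sum_nat.add
      ((tendsto_pow_atTop_nhds_zero_of_lt_one (by norm_num) (by norm_num)).smul_const _)
  rw [zero_smul, add_zero] at h1
  exact hcl.mem_of_tendsto h1 (Eventually.of_forall key)

/-- If the closure of the image of a bounded closed convex set is a neighbourhood of the origin,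
so is the image itself. -/
lemma image_mem_nhds_of_closure [CompleteSpace E] {B : Set E} (hc : Convex ℝ B) (hcl : IsClosed B)
    (hbd : Bornology.IsBounded B) (T : E →L[ℝ] F) (h : closure (T '' B) ∈ 𝓝 (0 : F)) :
    T '' B ∈ 𝓝 (0 : F) := by
  obtain ⟨δ, hδ, hball⟩ := Metric.mem_nhds_iff.1 h
  refine Metric.mem_nhds_iff.2 ⟨δ / 2, by positivity, fun v hv => ?_⟩
  have step : ∀ w : F, ‖w‖ < δ → ∃ b ∈ B, ‖(2 : ℝ) • (w - T b)‖ < δ := by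
    intro w hw
    have hw' : w ∈ closure (T '' B) := hball (by simpa using hw)
    obtain ⟨_, ⟨b, hbB, rfl⟩, hbd⟩ := Metric.mem_closure_iff.1 hw' (δ / 2) (by positivity)
    refine ⟨b, hbB, ?_⟩
    rw [norm_smul, ← dist_eq_norm]
    norm_num
    linarith
  choose! β hβB hβ using step
  -- `w n` is the residual after `n` terms, rescaled by `2 ^ (n + 1)`; doubling keeps it in the ball
  -- of radius `δ`, so the approximation can be repeated.
  let w : ℕ → F := fun n => Nat.rec ((2 : ℝ) • v) (fun _ u => (2 : ℝ) • (u - T (β u))) n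
  have hw0 : w 0 = (2 : ℝ) • v := rfl
  have hws : ∀ n, w (n + 1) = (2 : ℝ) • (w n - T (β (w n))) := fun n => rfl
  have hwn : ∀ n, ‖w n‖ < δ := by
    intro n
    induction n with
    | zero =>
      rw [hw0, norm_smul]
      have : ‖v‖ < δ / 2 := by simpa using hv
      norm_num
      linarith
    | succ n ih => rw [hws]; exact hβ _ ih
  obtain ⟨M, hM⟩ := hbd.exists_norm_le
  have hs : Summable fun n => ((1 : ℝ) / 2) ^ (n + 1) • β (w n) := by
    have hg : Summable fun n : ℕ => ((1 : ℝ) / 2) ^ n * ((1 / 2) * M) :=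
      (summable_geometric_of_lt_one (by norm_num) (by norm_num)).mul_right _
    refine Summable.of_norm_bounded hg fun n => ?_
    rw [norm_smul, norm_pow, pow_succ, mul_assoc]
    have := hM _ (hβB _ (hwn n))
    norm_num
    linarith
  refine ⟨_, tsum_dyadic_mem hc hcl (fun n => hβB _ (hwn n)) hs, ?_⟩
  have hpart : ∀ n, T (∑ i ∈ Finset.range n, ((1 : ℝ) / 2) ^ (i + 1) • β (w i))
      = v - ((1 : ℝ) / 2) ^ (n + 1) • w n := by
    intro n
    induction n with
    | zero => simp [hw0, smul_smul]
    | succ n ih =>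
      rw [Finset.sum_range_succ, map_add, ih, hws, map_smul, smul_smul,
        show ((1 : ℝ) / 2) ^ (n + 1 + 1) * 2 = (1 / 2) ^ (n + 1) by ring]
      module
  have hlim : Tendsto (fun n => v - ((1 : ℝ) / 2) ^ (n + 1) • w n) atTop (𝓝 v) := by
    have h0 : Tendsto (fun n => ((1 : ℝ) / 2) ^ (n + 1) • w n) atTop (𝓝 0) := by
      have hp : Tendsto (fun n : ℕ => ((1 : ℝ) / 2) ^ (n + 1) * δ) atTop (𝓝 0) := by
        simpa using ((tendsto_add_atTop_iff_nat 1).2 (tendsto_pow_atTop_nhds_zero_of_lt_one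
          (r := (1 : ℝ) / 2) (by norm_num) (by norm_num))).mul_const δ
      refine squeeze_zero_norm (fun n => ?_) hp
      rw [norm_smul, norm_pow, Real.norm_of_nonneg (by norm_num : (0 : ℝ) ≤ 1 / 2)]
      exact mul_le_mul_of_nonneg_left (hwn n).le (by positivity)
    simpa using tendsto_const_nhds.sub h0
  refine tendsto_nhds_unique ((T.continuous.tendsto _).comp hs.hasSum.tendsto_sum_nat) ?_
  refine hlim.congr fun n => (hpart n).symm

/-- An open mapping principle: if the images of an increasing sequence of bounded closed convex
sets absorb the whole Banach space, then one of them is a neighbourhood of the origin. -/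
lemma exists_image_mem_nhds_of_absorbing [CompleteSpace E] [CompleteSpace F] {B : ℕ → Set E} (hmono : Monotone B)
    (hc : ∀ n, Convex ℝ (B n)) (hcl : ∀ n, IsClosed (B n))
    (hbd : ∀ n, Bornology.IsBounded (B n)) (T : E →L[ℝ] F)
    (habs : ∀ v : F, ∃ n, ∃ t : ℝ, 0 < t ∧ t • v ∈ T '' B n) :
    ∃ n, T '' B n ∈ 𝓝 (0 : F) := by
  have hmonoT : ∀ {m n : ℕ}, m ≤ n → T '' B m ⊆ T '' B n := fun h => Set.image_mono (hmono h)
  have hcT : ∀ n, Convex ℝ (T '' B n) := fun n => (hc n).linear_image T.toLinearMap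
  -- Absorbing `0` puts the origin itself in some image; by convexity, larger images can then be
  -- scaled down.
  obtain ⟨n₀, t₀, -, hz⟩ := habs 0
  rw [smul_zero] at hz
  have hcov : ⋃ q : ℕ × ℕ, (fun v : F => ((1 : ℝ) / (q.2 + 1)) • v) ⁻¹' closure (T '' B q.1)
      = Set.univ := by
    refine Set.eq_univ_of_forall fun v => ?_
    obtain ⟨n, t, ht, hv⟩ := habs v
    obtain ⟨m, hm⟩ := exists_nat_gt (1 / t)
    refine Set.mem_iUnion.2 ⟨(max n n₀, m), subset_closure ?_⟩
    have hv' := hmonoT (le_max_left n n₀) hv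
    have hz' := hmonoT (le_max_right n n₀) hz
    have hlt : 1 < (m + 1) * t := by
      rw [div_lt_iff₀ ht] at hm
      nlinarith
    have hm0 : (0 : ℝ) < m + 1 := by positivity
    have := (hcT (max n n₀)).smul_mem_of_zero_mem hz' hv' (t := 1 / ((m + 1) * t))
      ⟨by positivity, by rw [div_le_one (by positivity)]; exact hlt.le⟩
    rw [smul_smul] at this
    convert this using 2
    field_simp
  obtain ⟨⟨n, m⟩, v, hv⟩ := nonempty_interior_of_iUnion_of_closed
    (fun q : ℕ × ℕ => isClosed_closure.preimage (continuous_const_smul _)) hcov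
  have hm0 : (0 : ℝ) < 1 / (m + 1) := by positivity
  have hv1 : ((1 : ℝ) / (m + 1)) • v ∈ interior (closure (T '' B n)) := by
    rw [mem_interior_iff_mem_nhds] at hv ⊢
    have := (smul_mem_nhds_smul_iff₀ hm0.ne').2 hv
    refine mem_of_superset this ?_
    rintro _ ⟨u, hu, rfl⟩
    exact hu
  set v₀ := ((1 : ℝ) / (m + 1)) • v
  -- Baire gives an interior point `v₀`, possibly nonzero; the origin lies strictly between it and
  -- the absorbed multiple of `-v₀`, hence is interior too.
  obtain ⟨k, t, ht, hk⟩ := habs (-v₀)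
  refine ⟨max n k, image_mem_nhds_of_closure (hc _) (hcl _) (hbd _) T ?_⟩
  rw [← mem_interior_iff_mem_nhds]
  refine (hcT (max n k)).closure.openSegment_interior_self_subset_interior
    (interior_mono (closure_mono (hmonoT (le_max_left n k))) hv1)
    (subset_closure (hmonoT (le_max_right n k) hk)) ?_
  refine ⟨t / (1 + t), 1 / (1 + t), by positivity, by positivity,
    by rw [← add_div, add_comm, div_self (by positivity)], ?_⟩
  module

end OpenMapping

/-! ### Conjugates, subgradients and proximal points. -/

section Basics

variable {X : Type*} [NormedAddCommGroup X] [InnerProductSpace ℝ X]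

lemma ereal_eq_coe {a : EReal} (h₁ : a ≠ ⊤) (h₂ : a ≠ ⊥) : ∃ r : ℝ, a = r :=
  ⟨a.toReal, (EReal.coe_toReal h₁ h₂).symm⟩

/-- Testing against real upper bounds turns extended-real inequalities into real ones over the
epigraph. -/
lemma ereal_le_iff_forall_coe {a b : EReal} : a ≤ b ↔ ∀ c : ℝ, b ≤ c → a ≤ c := by
  refine ⟨fun h c hc => h.trans hc, fun h => ?_⟩
  induction b with
  | bot =>
    refine le_of_eq (EReal.eq_bot_iff_forall_lt a |>.2 fun y => ?_)
    exact lt_of_le_of_lt (h (y - 1) bot_le) (by exact_mod_cast sub_one_lt y)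
  | coe b => exact h b le_rfl
  | top => exact le_top

/-- Subgradients described by means of the epigraph. -/
lemma mem_subdiff_iff_epi {f : X → EReal} {x u : X} :
    u ∈ subdiff f x ↔ ∃ a : ℝ, f x = a ∧
      ∀ (z : X) (b : ℝ), f z ≤ b → a + inner ℝ u (z - x) ≤ b := by
  constructor
  · rintro ⟨h₁, h₂, h⟩
    obtain ⟨a, ha⟩ := ereal_eq_coe h₁ h₂
    refine ⟨a, ha, fun z b hb => ?_⟩
    have := (h z).trans hb
    rw [ha] at this
    exact_mod_cast this
  · rintro ⟨a, ha, h⟩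
    refine ⟨by simp [ha], by simp [ha], fun z => ereal_le_iff_forall_coe.2 fun b hb => ?_⟩
    rw [ha]
    exact_mod_cast h z b hb

lemma conj_le_coe_iff {f : X → EReal} {u : X} {c : ℝ} :
    conj f u ≤ c ↔ ∀ (x : X) (a : ℝ), f x ≤ a → inner ℝ u x - a ≤ c := by
  rw [conj, iSup_le_iff]
  refine forall_congr' fun x => ?_
  constructor
  · intro h a ha
    have : ((inner ℝ u x : ℝ) : EReal) - a ≤ c := (EReal.sub_le_sub le_rfl ha).trans h
    exact_mod_cast this
  · intro h
    induction hfx : f x with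
    | bot =>
      have := h (inner ℝ u x - c - 1) (by simp [hfx])
      linarith
    | coe a => exact_mod_cast h a hfx.le
    | top => simp

lemma ProperConvexLsc.exists_coe {f : X → EReal} (hf : ProperConvexLsc f) :
    ∃ (x : X) (a : ℝ), f x = a := by
  obtain ⟨x, hx⟩ := hf.dom_nonempty
  obtain ⟨a, ha⟩ := ereal_eq_coe (ne_of_lt hx) (hf.ne_bot x)
  exact ⟨x, a, ha⟩

lemma ProperConvexLsc.isClosed_epi {f : X → EReal} (hf : ProperConvexLsc f) :
    IsClosed {p : X × ℝ | f p.1 ≤ (p.2 : EReal)} :=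
  hf.lsc.isClosed_epigraph.preimage
    (continuous_fst.prodMk (continuous_coe_real_ereal.comp continuous_snd))

lemma conj_ne_bot {f : X → EReal} (hf : ProperConvexLsc f) (u : X) : conj f u ≠ ⊥ := by
  obtain ⟨x, a, ha⟩ := hf.exists_coe
  have h : ((inner ℝ u x : ℝ) : EReal) - f x ≤ conj f u :=
    le_iSup (fun x => ((inner ℝ u x : ℝ) : EReal) - f x) x
  rw [ha] at h
  intro hb
  rw [hb, le_bot_iff] at h
  exact EReal.coe_ne_bot (inner ℝ u x - a) (by exact_mod_cast h)

/-- The Fenchel–Young inequality. -/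
lemma inner_le_of_le_of_conj_le {f : X → EReal} {x u : X} {a c : ℝ} (ha : f x ≤ a)
    (hc : conj f u ≤ c) : inner ℝ u x ≤ a + c := by
  have := conj_le_coe_iff.1 hc x a ha
  linarith

/-- A supremum of continuous affine functions is convex and lower semicontinuous. Only a point of
the domain must be supplied; in the main theorem it is the dual solution. -/
lemma properConvexLsc_conj {f : X → EReal} (hf : ProperConvexLsc f) {u : X}
    (hu : conj f u < ⊤) : ProperConvexLsc (conj f) where
  dom_nonempty := ⟨u, hu⟩
  ne_bot := conj_ne_bot hf
  convex_epigraph := by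
    intro p hp q hq s t hs ht hst
    simp only [Set.mem_ofPred_eq, conj_le_coe_iff] at hp hq ⊢
    intro x a ha
    have h₁ := mul_le_mul_of_nonneg_left (hp x a ha) hs
    have h₂ := mul_le_mul_of_nonneg_left (hq x a ha) ht
    have h₃ : inner ℝ (s • p + t • q).1 x = s * inner ℝ p.1 x + t * inner ℝ q.1 x := by
      simp [inner_add_left, real_inner_smul_left]
    have h₄ : (s • p + t • q).2 = s * p.2 + t * q.2 := by simp
    rw [h₃, h₄]
    have h₅ : a = s * a + t * a := by rw [← add_mul, hst, one_mul]
    linarith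
  lsc := by
    refine lowerSemicontinuous_iSup fun x => Continuous.lowerSemicontinuous ?_
    induction f x with
    | bot => simpa using continuous_const
    | coe a =>
      have : Continuous fun u : X => ((inner ℝ u x - a : ℝ) : EReal) :=
        continuous_coe_real_ereal.comp (by fun_prop)
      exact_mod_cast this
    | top => simpa using continuous_const

/-- Subgradients are characterized by equality in the Fenchel–Young inequality. -/
lemma mem_subdiff_iff_fenchel {f : X → EReal} {x u : X} :
    u ∈ subdiff f x ↔ ∃ a c : ℝ, f x = a ∧ conj f u = c ∧ a + c = inner ℝ u x := by
  rw [mem_subdiff_iff_epi]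
  constructor
  · rintro ⟨a, ha, h⟩
    refine ⟨a, inner ℝ u x - a, ha, le_antisymm ?_ ?_, by ring⟩
    · rw [conj_le_coe_iff]
      intro z b hb
      have := h z b hb
      rw [inner_sub_right] at this
      linarith
    · have h : ((inner ℝ u x : ℝ) : EReal) - f x ≤ conj f u :=
        le_iSup (fun x => ((inner ℝ u x : ℝ) : EReal) - f x) x
      rw [ha] at h
      exact_mod_cast h
  · rintro ⟨a, c, ha, hc, hac⟩
    refine ⟨a, ha, fun z b hb => ?_⟩
    have := inner_le_of_le_of_conj_le hb hc.le
    rw [inner_sub_right]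
    linarith

lemma mem_subdiff_conj_of_mem_subdiff {f : X → EReal} {x u : X} (h : u ∈ subdiff f x) :
    x ∈ subdiff (conj f) u := by
  obtain ⟨a, c, ha, hc, hac⟩ := mem_subdiff_iff_fenchel.1 h
  refine mem_subdiff_iff_epi.2 ⟨c, hc, fun w d hd => ?_⟩
  have := inner_le_of_le_of_conj_le ha.le hd
  rw [inner_sub_right, real_inner_comm w x, real_inner_comm u x]
  linarith

/-- The Fenchel–Moreau inversion rule for subdifferentials. -/
lemma mem_subdiff_of_mem_subdiff_conj [CompleteSpace X] {f : X → EReal}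
    (hf : ProperConvexLsc f) {x u : X} (h : x ∈ subdiff (conj f) u) : u ∈ subdiff f x := by
  obtain ⟨c, hc, hsub⟩ := mem_subdiff_iff_epi.1 h
  suffices hle : f x ≤ ((inner ℝ u x - c : ℝ) : EReal) by
    obtain ⟨a, ha⟩ := ereal_eq_coe (hle.trans_lt (EReal.coe_lt_top _)).ne (hf.ne_bot x)
    refine mem_subdiff_iff_fenchel.2 ⟨a, c, ha, hc, le_antisymm ?_
      (inner_le_of_le_of_conj_le ha.le hc.le)⟩
    rw [ha] at hle
    have : a ≤ inner ℝ u x - c := by exact_mod_cast hle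
    linarith
  by_contra hlt
  obtain ⟨φ, m, hφ, hm⟩ := geometric_hahn_banach_closed_point hf.convex_epigraph hf.isClosed_epi
    (x := (x, inner ℝ u x - c)) hlt
  set ℓ := φ.comp (ContinuousLinearMap.inl ℝ X ℝ)
  set s := φ (0, 1)
  have hsplit : ∀ (z : X) (b : ℝ), φ (z, b) = ℓ z + s * b := by
    intro z b
    have h1 : ((z, b) : X × ℝ) = (z, 0) + b • (0, 1) := by simp
    rw [h1, map_add, map_smul, smul_eq_mul, mul_comm b]
    rfl
  obtain ⟨w, hw⟩ : ∃ w : X, ∀ z, ℓ z = inner ℝ w z :=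
    ⟨(InnerProductSpace.toDual ℝ X).symm ℓ, fun z => by simp⟩
  simp only [hsplit, hw] at hm
  have hφ' : ∀ (z : X) (b : ℝ), f z ≤ b → inner ℝ w z + s * b < m := by
    intro z b hb
    have := hφ (z, b) hb
    rwa [hsplit, hw] at this
  obtain ⟨z₀, a₀, hz₀⟩ := hf.exists_coe
  -- The epigraph is unbounded upwards, so a positive vertical slope would violate the separation.
  have hs : s ≤ 0 := by
    by_contra hpos
    push Not at hpos
    have h1 := hφ' z₀ (max a₀ ((m - inner ℝ w z₀) / s)) (by rw [hz₀]; exact_mod_cast le_max_left _ _)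
    have h2 := mul_le_mul_of_nonneg_left (le_max_right a₀ ((m - inner ℝ w z₀) / s)) hpos.le
    rw [mul_div_cancel₀ _ hpos.ne'] at h2
    linarith
  -- Vertical hyperplane: `w` is bounded by `m` on `dom f`, and `u + w` violates the subgradient
  -- inequality. Otherwise the hyperplane is an affine minorant of `f`, and its slope `(-s)⁻¹ • w`
  -- violates it.
  rcases hs.eq_or_lt with hs0 | hsneg
  · have hcon : conj f (u + w) ≤ ((c + m : ℝ) : EReal) := by
      rw [conj_le_coe_iff]
      intro z b hb
      have h1 := hφ' z b hb
      have h2 := inner_le_of_le_of_conj_le hb hc.le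
      rw [hs0] at h1
      rw [inner_add_left]
      linarith
    have := hsub _ _ hcon
    rw [add_sub_cancel_left, real_inner_comm] at this
    rw [hs0] at hm
    linarith
  · have hinv : (-s)⁻¹ * s = -1 := by
      rw [inv_neg, neg_mul, inv_mul_cancel₀ hsneg.ne]
    have hcon : conj f ((-s)⁻¹ • w) ≤ (((-s)⁻¹ * m : ℝ) : EReal) := by
      rw [conj_le_coe_iff]
      intro z b hb
      have h1 := mul_le_mul_of_nonneg_left (hφ' z b hb).le (a := (-s)⁻¹) (by
        rw [inv_nonneg]; linarith)
      rw [real_inner_smul_left]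
      have h3 : (-s)⁻¹ * (inner ℝ w z + s * b) = (-s)⁻¹ * inner ℝ w z - b := by
        linear_combination b * hinv
      linarith
    have h1 := hsub _ _ hcon
    rw [inner_sub_right, real_inner_smul_right, real_inner_comm w x, real_inner_comm u x] at h1
    have h2 := mul_lt_mul_of_pos_left hm (a := (-s)⁻¹) (by rw [inv_pos]; linarith)
    have h3 : (-s)⁻¹ * (inner ℝ w x + s * (inner ℝ u x - c))
        = (-s)⁻¹ * inner ℝ w x - (inner ℝ u x - c) := by
      linear_combination (inner ℝ u x - c) * hinv
    linarith

lemma subdiff_monotone {f : X → EReal} {x z u v : X} (hu : u ∈ subdiff f x)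
    (hv : v ∈ subdiff f z) : 0 ≤ inner ℝ (u - v) (x - z) := by
  obtain ⟨a, ha, hu⟩ := mem_subdiff_iff_epi.1 hu
  obtain ⟨b, hb, hv⟩ := mem_subdiff_iff_epi.1 hv
  have h₁ := hu z b hb.le
  have h₂ := hv x a ha.le
  simp only [inner_sub_left, inner_sub_right] at h₁ h₂ ⊢
  linarith

/-- The graph of the subdifferential is sequentially closed. -/
lemma mem_subdiff_of_tendsto {f : X → EReal} (hf : ProperConvexLsc f) {x u : ℕ → X} {x₀ u₀ : X}
    (hx : Tendsto x atTop (𝓝 x₀)) (hu : Tendsto u atTop (𝓝 u₀))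
    (h : ∀ n, u n ∈ subdiff f (x n)) : u₀ ∈ subdiff f x₀ := by
  -- Closedness of the epigraph carries the upper bound on `f (x n)` to the limit, without
  -- convergence of the values.
  have key : ∀ (z : X) (b : ℝ), f z ≤ b → f x₀ ≤ ((b - inner ℝ u₀ (z - x₀) : ℝ) : EReal) := by
    intro z b hb
    have hlim : Tendsto (fun n => (x n, b - inner ℝ (u n) (z - x n))) atTop
        (𝓝 (x₀, b - inner ℝ u₀ (z - x₀))) :=
      hx.prodMk_nhds (tendsto_const_nhds.sub (hu.inner (tendsto_const_nhds.sub hx)))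
    refine hf.isClosed_epi.mem_of_tendsto hlim (Eventually.of_forall fun n => ?_)
    obtain ⟨a, ha, hsub⟩ := mem_subdiff_iff_epi.1 (h n)
    have := hsub z b hb
    change f (x n) ≤ _
    rw [ha]
    exact_mod_cast (by linarith : a ≤ b - inner ℝ (u n) (z - x n))
  obtain ⟨z, b, hz⟩ := hf.exists_coe
  obtain ⟨a, ha⟩ := ereal_eq_coe ((key z b hz.le).trans_lt (EReal.coe_lt_top _)).ne (hf.ne_bot x₀)
  refine mem_subdiff_iff_epi.2 ⟨a, ha, fun z b hb => ?_⟩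
  have := key z b hb
  rw [ha] at this
  have : a ≤ b - inner ℝ u₀ (z - x₀) := by exact_mod_cast this
  linarith

lemma nonneg_of_forall_add_sq_nonneg {A B : ℝ}
    (h : ∀ t : ℝ, 0 < t → t ≤ 1 → 0 ≤ t * A + t ^ 2 * B) : 0 ≤ A := by
  have hlim : Tendsto (fun t : ℝ => A + t * B) (𝓝[>] 0) (𝓝 A) := by
    have : Tendsto (fun t : ℝ => A + t * B) (𝓝 0) (𝓝 (A + 0 * B)) :=
      Continuous.tendsto (by fun_prop) 0
    rw [zero_mul, add_zero] at this
    exact this.mono_left nhdsWithin_le_nhds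
  refine ge_of_tendsto hlim ?_
  filter_upwards [Ioc_mem_nhdsGT (zero_lt_one' ℝ)] with t ht
  have h1 : 0 ≤ t * (A + t * B) := by linarith [h t ht.1 ht.2]
  exact nonneg_of_mul_nonneg_right h1 ht.1

/-- The optimality condition that characterizes proximal points. -/
lemma IsProx.mem_subdiff {f : X → EReal} (hf : ProperConvexLsc f) {γ : ℝ} {x p : X}
    (h : IsProx γ f x p) : γ⁻¹ • (x - p) ∈ subdiff f p := by
  have htop : f p ≠ ⊤ := by
    intro ht
    obtain ⟨z, b, hz⟩ := hf.exists_coe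
    have := h z
    rw [ht, hz, EReal.top_add_coe, top_le_iff] at this
    exact EReal.coe_ne_top _ (by exact_mod_cast this)
  obtain ⟨a, ha⟩ := ereal_eq_coe htop (hf.ne_bot p)
  refine mem_subdiff_iff_epi.2 ⟨a, ha, fun z b hb => ?_⟩
  suffices 0 ≤ (b - a) - γ⁻¹ * inner ℝ (x - p) (z - p) by
    rw [real_inner_smul_left]
    linarith
  refine nonneg_of_forall_add_sq_nonneg (B := ‖z - p‖ ^ 2 / (2 * γ)) fun t ht ht1 => ?_
  -- Minimality is tested on the segment from `p` to `z`: the linear term in `t` is the subgradient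
  -- inequality, and the quadratic term vanishes as `t → 0`.
  have hmem := hf.convex_epigraph (x := (p, a)) ha.le (y := (z, b)) hb
    (a := 1 - t) (b := t) (by linarith) ht.le (by ring)
  have h1 := (h ((1 - t) • p + t • z)).trans (add_le_add_left (show f _ ≤
    (((1 - t) * a + t * b : ℝ) : EReal) from hmem) _)
  rw [ha] at h1
  have h2 : a + ‖p - x‖ ^ 2 / (2 * γ) ≤ (1 - t) * a + t * b
      + ‖(1 - t) • p + t • z - x‖ ^ 2 / (2 * γ) := by exact_mod_cast h1
  have h3 : (1 - t) • p + t • z - x = (p - x) + t • (z - p) := by module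
  have h4 : inner ℝ (x - p) (z - p) = - inner ℝ (p - x) (z - p) := by
    rw [← inner_neg_left, neg_sub]
  rw [h3, norm_add_sq_real, real_inner_smul_right, norm_smul, mul_pow, Real.norm_eq_abs,
    sq_abs] at h2
  rw [h4]
  have h5 : (‖p - x‖ ^ 2 + 2 * (t * inner ℝ (p - x) (z - p)) + t ^ 2 * ‖z - p‖ ^ 2) / (2 * γ)
      = ‖p - x‖ ^ 2 / (2 * γ) + t * (γ⁻¹ * inner ℝ (p - x) (z - p))
        + t ^ 2 * (‖z - p‖ ^ 2 / (2 * γ)) := by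
    ring
  linarith

end Basics

/-! ### Multipliers and qualification conditions. -/

section Duality

variable {X : Type*} [NormedAddCommGroup X] [InnerProductSpace ℝ X]
variable {Y : Type*} [NormedAddCommGroup Y] [InnerProductSpace ℝ Y]

lemma ProperConvexLsc.convex_sublevel {f : X → EReal} (hf : ProperConvexLsc f) (r : ℝ) :
    Convex ℝ {x | f x ≤ (r : EReal)} := by
  intro x hx z hz s t hs ht hst
  have h := hf.convex_epigraph (x := (x, r)) hx (y := (z, r)) hz hs ht hst
  have h2 : s * r + t * r = r := by rw [← add_mul, hst, one_mul]
  simpa [h2] using h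

lemma ProperConvexLsc.isClosed_sublevel {f : X → EReal} (hf : ProperConvexLsc f) (r : ℝ) :
    IsClosed {x | f x ≤ (r : EReal)} :=
  hf.lsc.isClosed_preimage _

/-- A Lagrange multiplier exists if the cone generated by `dom g - K (dom f)` is a closed
subspace. -/
lemma exists_multiplier [CompleteSpace X] [CompleteSpace Y] {f : X → EReal} {g : Y → EReal}
    {K : X →L[ℝ] Y} (hf : ProperConvexLsc f) (hg : ProperConvexLsc g) (hQC : QC3 f g K) {p : ℝ}
    (hp : ∀ (x : X) (a b : ℝ), f x ≤ a → g (K x) ≤ b → p ≤ a + b) :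
    ∃ y : Y, ∀ (x : X) (z : Y) (a b : ℝ), f x ≤ a → g z ≤ b →
      p + inner ℝ y (z - K x) ≤ a + b := by
  obtain ⟨-, V, hV, hcone⟩ := hQC
  have hsub : ∀ x z, f x < ⊤ → g z < ⊤ → z - K x ∈ V := by
    intro x z hx hz
    have : z - K x ∈ (V : Set Y) := by
      rw [← hcone]
      refine Set.mem_iUnion₂.2 ⟨1, Set.mem_Ioi.2 one_pos, ?_⟩
      rw [one_smul]
      exact ⟨_, ⟨z, hz, _, ⟨x, hx, rfl⟩, rfl⟩, 0, rfl, sub_zero _⟩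
    exact this
  have habs : ∀ v ∈ V, ∃ t : ℝ, 0 < t ∧ ∃ x z, f x < ⊤ ∧ g z < ⊤ ∧ v = t • (z - K x) := by
    intro v hv
    have hv' : v ∈ (V : Set Y) := hv
    rw [← hcone] at hv'
    obtain ⟨t, ht, _, ⟨_, ⟨z, hz, _, ⟨x, hx, rfl⟩, rfl⟩, _, rfl, rfl⟩, rfl⟩ :=
      Set.mem_iUnion₂.1 hv'
    exact ⟨t, ht, x, z, hx, hz, by simp⟩
  have : CompleteSpace V := hV.completeSpace_coe
  -- The projection is the identity on all differences from the domains; it only makes the map take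
  -- values in the Banach space `V`.
  let T : X × Y →L[ℝ] V := V.orthogonalProjectionOnto.comp
    (ContinuousLinearMap.snd ℝ X Y - K.comp (ContinuousLinearMap.fst ℝ X Y))
  have hT : ∀ x z, f x < ⊤ → g z < ⊤ → (T (x, z) : Y) = z - K x := by
    intro x z hx hz
    exact congrArg Subtype.val
      (Submodule.orthogonalProjectionOnto_mem_subspace_eq_self (⟨z - K x, hsub x z hx hz⟩ : V))
  -- Truncating both norms and values gives bounded closed convex sets whose images absorb `V`, with
  -- `f` and `g` bounded by `n` on them.
  let B : ℕ → Set (X × Y) := fun n =>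
    Metric.closedBall 0 n ∩ ({x | f x ≤ ((n : ℝ) : EReal)} ×ˢ {z | g z ≤ ((n : ℝ) : EReal)})
  obtain ⟨N, hN⟩ := exists_image_mem_nhds_of_absorbing (B := B)
    (fun m n hmn => by
      have hmn' : ((m : ℝ) : EReal) ≤ ((n : ℝ) : EReal) := by exact_mod_cast hmn
      exact Set.inter_subset_inter (Metric.closedBall_subset_closedBall (by exact_mod_cast hmn))
        (Set.prod_mono (fun x hx => le_trans hx hmn') (fun x hx => le_trans hx hmn')))
    (fun n => (convex_closedBall _ _).inter ((hf.convex_sublevel n).prod (hg.convex_sublevel n)))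
    (fun n => Metric.isClosed_closedBall.inter
      ((hf.isClosed_sublevel n).prod (hg.isClosed_sublevel n)))
    (fun n => Metric.isBounded_closedBall.subset Set.inter_subset_left) T
    (by
      rintro ⟨v, hv⟩
      obtain ⟨t, ht, x, z, hx, hz, rfl⟩ := habs v hv
      obtain ⟨a, ha⟩ := ereal_eq_coe hx.ne (hf.ne_bot x)
      obtain ⟨b, hb⟩ := ereal_eq_coe hz.ne (hg.ne_bot z)
      obtain ⟨n, hn⟩ := exists_nat_ge (max ‖(x, z)‖ (max a b))
      refine ⟨n, t⁻¹, inv_pos.2 ht, (x, z), ⟨?_, ?_, ?_⟩, ?_⟩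
      · simpa using (le_max_left _ _).trans hn
      · change f x ≤ _
        rw [ha]
        exact_mod_cast ((le_max_left _ _).trans (le_max_right _ _)).trans hn
      · change g z ≤ _
        rw [hb]
        exact_mod_cast ((le_max_right _ _).trans (le_max_right _ _)).trans hn
      · apply Subtype.ext
        rw [hT x z hx hz]
        simp [smul_smul, inv_mul_cancel₀ ht.ne'])
  let L : (X × ℝ) × (Y × ℝ) →ₗ[ℝ] V × ℝ :=
    (T.toLinearMap ∘ₗ ((LinearMap.fst ℝ X ℝ).prodMap (LinearMap.fst ℝ Y ℝ))).prod
      ((LinearMap.snd ℝ X ℝ).coprod (LinearMap.snd ℝ Y ℝ))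
  have hL : ∀ x a z b, L ((x, a), (z, b)) = (T (x, z), a + b) := fun x a z b => rfl
  let Q : Set (V × ℝ) := L ''
    ({q : X × ℝ | f q.1 ≤ (q.2 : EReal)} ×ˢ {q : Y × ℝ | g q.1 ≤ (q.2 : EReal)})
  have hQ : ∀ {v : V} {r : ℝ}, (v, r) ∈ Q ↔ ∃ x z, ∃ a b : ℝ, f x ≤ a ∧ g z ≤ b ∧
      (v : Y) = z - K x ∧ r = a + b := by
    intro v r
    constructor
    · rintro ⟨⟨⟨x, a⟩, ⟨z, b⟩⟩, ⟨hx, hz⟩, h⟩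
      rw [hL, Prod.mk.injEq] at h
      refine ⟨x, z, a, b, hx, hz, ?_, h.2.symm⟩
      rw [← h.1, hT x z (lt_of_le_of_lt hx (EReal.coe_lt_top _))
        (lt_of_le_of_lt hz (EReal.coe_lt_top _))]
    · rintro ⟨x, z, a, b, hx, hz, h₁, h₂⟩
      refine ⟨((x, a), (z, b)), ⟨hx, hz⟩, ?_⟩
      rw [hL, h₂, Prod.mk.injEq]
      refine ⟨Subtype.ext ?_, rfl⟩
      rw [h₁, hT x z (lt_of_le_of_lt hx (EReal.coe_lt_top _))
        (lt_of_le_of_lt hz (EReal.coe_lt_top _))]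
  have hQconv : Convex ℝ Q := (hf.convex_epigraph.prod hg.convex_epigraph).linear_image L
  have hint : ∀ r : ℝ, 2 * N < r → ((0 : V), r) ∈ interior Q := by
    intro r hr
    rw [mem_interior_iff_mem_nhds]
    refine mem_of_superset (prod_mem_nhds hN (Ioi_mem_nhds hr)) ?_
    rintro ⟨v, s⟩ ⟨⟨⟨x, z⟩, ⟨-, hx, hz⟩, rfl⟩, hs⟩
    have hs' : 2 * (N : ℝ) < s := hs
    refine hQ.2 ⟨x, z, N, s - N, hx, le_trans hz ?_, hT x z (lt_of_le_of_lt hx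
      (EReal.coe_lt_top _)) (lt_of_le_of_lt hz (EReal.coe_lt_top _)), by ring⟩
    exact_mod_cast (by linarith : (N : ℝ) ≤ s - N)
  have hlow : ∀ r : ℝ, ((0 : V), r) ∈ Q → p ≤ r := by
    intro r hr
    obtain ⟨x, z, a, b, hx, hz, h₁, rfl⟩ := hQ.1 hr
    have : z = K x := by
      rw [← sub_eq_zero, ← h₁]
      rfl
    exact hp x a b hx (this ▸ hz)
  -- An interior point would have points of `Q` directly below it, contradicting the lower bound
  -- `p`.
  have hnot : ((0 : V), p) ∉ interior Q := by
    intro h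
    rw [mem_interior_iff_mem_nhds] at h
    have hlim : Tendsto (fun r : ℝ => ((0 : V), r)) (𝓝 p) (𝓝 ((0 : V), p)) :=
      Continuous.tendsto (by fun_prop) p
    have hev : ∀ᶠ r in 𝓝[<] p, ((0 : V), r) ∈ Q := nhdsWithin_le_nhds (hlim h)
    obtain ⟨r, hr, hrp⟩ := (hev.and self_mem_nhdsWithin).exists
    exact absurd (hlow r hr) (not_le.2 hrp)
  have hr₀ := hint (2 * N + 1) (by linarith)
  obtain ⟨φ, hφne, hφ⟩ : ∃ φ : StrongDual ℝ (V × ℝ), (∀ q ∈ interior Q, φ q < φ (0, p)) ∧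
      ∀ q ∈ Q, φ q ≤ φ (0, p) := by
    obtain ⟨φ, hφ⟩ := geometric_hahn_banach_open_point hQconv.interior isOpen_interior hnot
    refine ⟨φ, hφ, fun q hq => ?_⟩
    have hq' : q ∈ closure (interior Q) := by
      rw [hQconv.closure_interior_eq_closure_of_nonempty_interior ⟨_, hr₀⟩]
      exact subset_closure hq
    exact closure_minimal (fun q hq => (hφ q hq).le) (isClosed_le φ.continuous continuous_const) hq'
  set c := φ (0, 1)
  have hsplit : ∀ (v : V) (r : ℝ), φ (v, r) = φ (v, 0) + c * r := by
    intro v r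
    have h1 : ((v, r) : V × ℝ) = (v, 0) + r • (0, 1) := by simp
    rw [h1, map_add, map_smul, smul_eq_mul, mul_comm r]
  have hzero : φ ((0 : V), (0 : ℝ)) = 0 := map_zero φ
  -- The hyperplane is not vertical, because high points over `0` are interior to `Q` and strictly
  -- separated.
  have hc : c < 0 := by
    have h₁ := hφne _ (hint (max (2 * (N : ℝ)) p + 1) (by linarith [le_max_left (2 * (N : ℝ)) p]))
    rw [hsplit, hsplit 0 p, hzero] at h₁
    by_contra hneg
    push Not at hneg
    have := mul_le_mul_of_nonneg_left
      (by linarith [le_max_right (2 * (N : ℝ)) p] : p ≤ max (2 * (N : ℝ)) p + 1) hneg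
    linarith
  let ℓ : StrongDual ℝ V := φ.comp (ContinuousLinearMap.inl ℝ V ℝ)
  let w : V := (InnerProductSpace.toDual ℝ V).symm ℓ
  have hw : ∀ v : V, φ (v, 0) = inner ℝ (w : Y) (v : Y) := by
    intro v
    have : inner ℝ w v = ℓ v := InnerProductSpace.toDual_symm_apply
    rw [← Submodule.coe_inner, this]
    rfl
  refine ⟨(-c)⁻¹ • (w : Y), fun x z a b hx hz => ?_⟩
  have hv := hsub x z (lt_of_le_of_lt hx (EReal.coe_lt_top _))
    (lt_of_le_of_lt hz (EReal.coe_lt_top _))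
  have h₁ := hφ (⟨z - K x, hv⟩, a + b) (hQ.2 ⟨x, z, a, b, hx, hz, rfl, rfl⟩)
  rw [hsplit, hsplit 0 p, hzero, hw] at h₁
  have h₂ := mul_le_mul_of_nonneg_left h₁ (inv_nonneg.2 (by linarith : (0 : ℝ) ≤ -c))
  have hinv : (-c)⁻¹ * c = -1 := by rw [inv_neg, neg_mul, inv_mul_cancel₀ hc.ne]
  rw [real_inner_smul_left]
  have h₃ : (-c)⁻¹ * (inner ℝ (w : Y) (z - K x) + c * (a + b))
      = (-c)⁻¹ * inner ℝ (w : Y) (z - K x) - (a + b) := by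
    linear_combination (a + b) * hinv
  have h₄ : (-c)⁻¹ * (0 + c * p) = -p := by linear_combination p * hinv
  rw [h₄] at h₂
  change (-c)⁻¹ * (inner ℝ (w : Y) (z - K x) + c * (a + b)) ≤ -p at h₂
  linarith

/-- Continuity keeps `g` below `⊤` near `K x'`, so moving only the point of `dom g` covers a
neighbourhood of `0`. -/
lemma QC2_of_QC1 {f : X → EReal} {g : Y → EReal} {K : X →L[ℝ] Y} (h : QC1 f g K) :
    QC2 f g K := by
  obtain ⟨x, ⟨hx, hKx⟩, hcont⟩ := h
  have h₁ : effDom g ∈ 𝓝 (K x) := hcont.eventually (Iio_mem_nhds hKx)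
  have h₂ : (fun v : Y => v + K x) ⁻¹' effDom g ∈ 𝓝 (0 : Y) :=
    (Continuous.continuousAt (by fun_prop)).preimage_mem_nhds (by simpa using h₁)
  refine mem_interior_iff_mem_nhds.2 (mem_of_superset h₂ fun v hv => ?_)
  exact ⟨v + K x, hv, K x, ⟨x, hx, rfl⟩, add_sub_cancel_right _ _⟩

/-- A neighbourhood of `0` absorbs every vector, so the cone is the whole space. -/
lemma QC3_of_QC2 {f : X → EReal} {g : Y → EReal} {K : X →L[ℝ] Y} (h : QC2 f g K) :
    QC3 f g K := by
  refine ⟨interior_subset h, ⊤, by simp, ?_⟩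
  refine Set.eq_univ_of_forall fun v => ?_
  have hlim : Tendsto (fun t : ℝ => t⁻¹ • v) atTop (𝓝 0) := by
    simpa using (tendsto_inv_atTop_zero (𝕜 := ℝ)).smul_const v
  have hev : ∀ᶠ t : ℝ in atTop, t⁻¹ • v ∈ effDom g - K '' effDom f :=
    hlim (mem_interior_iff_mem_nhds.1 h)
  obtain ⟨t, ht, htpos⟩ := (hev.and (eventually_gt_atTop (0 : ℝ))).exists
  refine Set.mem_iUnion₂.2 ⟨t, htpos, t⁻¹ • v, ⟨_, ht, 0, rfl, sub_zero _⟩, ?_⟩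
  simp [smul_smul, mul_inv_cancel₀ htpos.ne']

end Duality

/-! ### Saddle points and strong duality. -/

section Saddle

variable {X : Type*} [NormedAddCommGroup X] [InnerProductSpace ℝ X] [CompleteSpace X]
variable {Y : Type*} [NormedAddCommGroup Y] [InnerProductSpace ℝ Y] [CompleteSpace Y]
variable {f : X → EReal} {g : Y → EReal} {K : X →L[ℝ] Y}

/-- `(x, y)` satisfies the optimality conditions of the primal-dual pair. -/
def IsSaddle (f : X → EReal) (g : Y → EReal) (K : X →L[ℝ] Y) (x : X) (y : Y) : Prop :=
  -(ContinuousLinearMap.adjoint K y) ∈ subdiff f x ∧ y ∈ subdiff g (K x)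

lemma inner_neg_adjoint (K : X →L[ℝ] Y) (x : X) (y : Y) :
    inner ℝ (-(ContinuousLinearMap.adjoint K y)) x = -inner ℝ y (K x) := by
  rw [inner_neg_left, ContinuousLinearMap.adjoint_inner_left]

lemma dualObj_le_primalObj (hf : ProperConvexLsc f) (hg : ProperConvexLsc g) (x : X) (y : Y) :
    dualObj f g K y ≤ primalObj f g K x := by
  unfold dualObj primalObj
  by_cases ha : f x = ⊤
  · rw [ha, EReal.top_add_of_ne_bot (hg.ne_bot _)]
    exact le_top
  by_cases hb : g (K x) = ⊤
  · rw [hb, EReal.add_top_of_ne_bot (hf.ne_bot _)]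
    exact le_top
  by_cases hc : conj f (-(ContinuousLinearMap.adjoint K y)) = ⊤
  · simp [hc, sub_eq_add_neg]
  by_cases hd : conj g y = ⊤
  · simp [hd, sub_eq_add_neg]
  obtain ⟨a, ha⟩ := ereal_eq_coe ha (hf.ne_bot _)
  obtain ⟨b, hb⟩ := ereal_eq_coe hb (hg.ne_bot _)
  obtain ⟨c, hc⟩ := ereal_eq_coe hc (conj_ne_bot hf _)
  obtain ⟨d, hd⟩ := ereal_eq_coe hd (conj_ne_bot hg _)
  have h₁ := inner_le_of_le_of_conj_le ha.le hc.le
  have h₂ := inner_le_of_le_of_conj_le hb.le hd.le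
  rw [inner_neg_adjoint] at h₁
  rw [ha, hb, hc, hd]
  exact_mod_cast (by linarith : -c - d ≤ a + b)

lemma IsSaddle.primalObj_eq_dualObj {x : X} {y : Y} (h : IsSaddle f g K x y) :
    primalObj f g K x = dualObj f g K y := by
  obtain ⟨a, c, ha, hc, hac⟩ := mem_subdiff_iff_fenchel.1 h.1
  obtain ⟨b, d, hb, hd, hbd⟩ := mem_subdiff_iff_fenchel.1 h.2
  rw [inner_neg_adjoint] at hac
  rw [primalObj, dualObj, ha, hb, hc, hd]
  exact_mod_cast (by linarith : a + b = -c - d)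

lemma IsSaddle.isPrimalOptimal (hf : ProperConvexLsc f) (hg : ProperConvexLsc g) {x : X} {y : Y}
    (h : IsSaddle f g K x y) : IsPrimalOptimal f g K x := fun z =>
  h.primalObj_eq_dualObj.trans_le (dualObj_le_primalObj hf hg z y)

lemma IsSaddle.isDualOptimal (hf : ProperConvexLsc f) (hg : ProperConvexLsc g) {x : X} {y : Y}
    (h : IsSaddle f g K x y) : IsDualOptimal f g K y := fun z =>
  (dualObj_le_primalObj hf hg x z).trans_eq h.primalObj_eq_dualObj

lemma IsSaddle.iInf_eq_iSup (hf : ProperConvexLsc f) (hg : ProperConvexLsc g) {x : X} {y : Y}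
    (h : IsSaddle f g K x y) : (⨅ x, primalObj f g K x) = ⨆ y, dualObj f g K y := by
  refine le_antisymm ?_ (iSup_le fun z => le_iInf fun w => dualObj_le_primalObj hf hg w z)
  exact (iInf_le _ x).trans (h.primalObj_eq_dualObj.trans_le (le_iSup (dualObj f g K) y))

/-- Strong duality: an optimal solution of the primal problem has a dual counterpart. -/
lemma exists_isSaddle (hf : ProperConvexLsc f) (hg : ProperConvexLsc g) (hQC : QC3 f g K) {x : X}
    (hx : IsPrimalOptimal f g K x) : ∃ y, IsSaddle f g K x y := by
  obtain ⟨z, hz, _, ⟨w, hw, rfl⟩, hzw⟩ := hQC.1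
  have hzw : z = K w := sub_eq_zero.1 hzw
  subst hzw
  have hfin : f x + g (K x) ≠ ⊤ :=
    ((hx w).trans_lt (EReal.add_lt_top (ne_of_lt hw) (ne_of_lt hz))).ne
  rw [EReal.add_ne_top_iff_ne_top₂ (hf.ne_bot _) (hg.ne_bot _)] at hfin
  obtain ⟨a, ha⟩ := ereal_eq_coe hfin.1 (hf.ne_bot _)
  obtain ⟨b, hb⟩ := ereal_eq_coe hfin.2 (hg.ne_bot _)
  obtain ⟨y, hy⟩ := exists_multiplier hf hg hQC (p := a + b) (fun u c d hc hd => by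
    have h := (hx u).trans (add_le_add hc hd)
    rw [primalObj, ha, hb] at h
    exact_mod_cast h)
  -- Freezing the `Y` variable at `K x`, or the `X` variable at `x`, splits the multiplier
  -- inequality into the two subgradient conditions.
  refine ⟨y, mem_subdiff_iff_epi.2 ⟨a, ha, fun u c hc => ?_⟩,
    mem_subdiff_iff_epi.2 ⟨b, hb, fun v d hd => ?_⟩⟩
  · have := hy u (K x) c b hc hb.le
    rw [inner_neg_adjoint, map_sub, ← inner_neg_right, neg_sub]
    linarith
  · have := hy x v a d ha.le hd
    linarith

/-- A zero duality gap forces equality in both Fenchel–Young inequalities, so every dual solution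
pairs with the same `x`. -/
lemma IsSaddle.of_isDualOptimal (hf : ProperConvexLsc f) (hg : ProperConvexLsc g) {x : X}
    {y y' : Y} (h : IsSaddle f g K x y) (hy' : IsDualOptimal f g K y') :
    IsSaddle f g K x y' := by
  obtain ⟨a, -, ha, -, -⟩ := mem_subdiff_iff_fenchel.1 h.1
  obtain ⟨b, -, hb, -, -⟩ := mem_subdiff_iff_fenchel.1 h.2
  have hle : ((a + b : ℝ) : EReal) ≤ dualObj f g K y' := by
    refine le_trans ?_ (hy' y)
    rw [← h.primalObj_eq_dualObj, primalObj, ha, hb, EReal.coe_add]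
  rw [dualObj] at hle
  have hc : conj f (-(ContinuousLinearMap.adjoint K y')) ≠ ⊤ := by
    intro hc
    rw [hc, sub_eq_add_neg, EReal.neg_top, EReal.bot_add, le_bot_iff] at hle
    exact EReal.coe_ne_bot _ hle
  have hd : conj g y' ≠ ⊤ := by
    intro hd
    rw [hd, sub_eq_add_neg, EReal.neg_top, EReal.add_bot, le_bot_iff] at hle
    exact EReal.coe_ne_bot _ hle
  obtain ⟨c, hc⟩ := ereal_eq_coe hc (conj_ne_bot hf _)
  obtain ⟨d, hd⟩ := ereal_eq_coe hd (conj_ne_bot hg _)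
  rw [hc, hd] at hle
  have hle' : a + b ≤ -c - d := by exact_mod_cast hle
  have h₁ := inner_le_of_le_of_conj_le ha.le hc.le
  have h₂ := inner_le_of_le_of_conj_le hb.le hd.le
  have h₃ := inner_neg_adjoint K x y'
  exact ⟨mem_subdiff_iff_fenchel.2 ⟨a, c, ha, hc, by linarith⟩,
    mem_subdiff_iff_fenchel.2 ⟨b, d, hb, hd, by linarith⟩⟩

end Saddle

/-! ### Energy decrease and convergence of the primal-dual iteration. -/

section Algorithm

variable {X : Type*} [NormedAddCommGroup X] [InnerProductSpace ℝ X]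
variable {Y : Type*} [NormedAddCommGroup Y] [InnerProductSpace ℝ Y]
variable {f : X → EReal} {g : Y → EReal} {K : X →L[ℝ] Y}

lemma abs_inner_apply_le (K : X →L[ℝ] Y) (u : X) (w : Y) :
    |inner ℝ (K u) w| ≤ ‖K‖ * ‖u‖ * ‖w‖ :=
  (abs_real_inner_le_norm _ _).trans
    (mul_le_mul_of_nonneg_right (K.le_opNorm u) (norm_nonneg w))

/-- Weighted Young inequality by completing a square. Taking `s = 1` gives monotone energy, while
some `s < 1` leaves a strict decrease. -/
lemma inner_apply_le_of_le_sq {σ τ s : ℝ} (hσ : 0 < σ) (hτ : 0 < τ) (hs : 0 < s)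
    (hK : σ * τ * ‖K‖ ^ 2 ≤ s ^ 2) (u : X) (w : Y) :
    inner ℝ (K u) w ≤ s * (‖u‖ ^ 2 / (2 * τ) + ‖w‖ ^ 2 / (2 * σ)) := by
  refine ((le_abs_self _).trans (abs_inner_apply_le K u w)).trans ?_
  rw [← sub_nonneg]
  have h : s * (‖u‖ ^ 2 / (2 * τ) + ‖w‖ ^ 2 / (2 * σ)) - ‖K‖ * ‖u‖ * ‖w‖
      = s / (2 * σ) * (‖w‖ - ‖K‖ * σ * ‖u‖ / s) ^ 2
        + ‖u‖ ^ 2 / (2 * s * τ) * (s ^ 2 - σ * τ * ‖K‖ ^ 2) := by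
    field_simp
    ring
  rw [h]
  have := sub_nonneg.2 hK
  positivity

/-- The weights are unbalanced on purpose: the `u` term is cancelled exactly by the energy, so all
the loss falls on the dual distance. -/
lemma neg_inner_apply_le {σ τ : ℝ} (hσ : 0 < σ) (hτ : 0 < τ) (u : X) (w : Y) :
    -inner ℝ (K u) w ≤ ‖u‖ ^ 2 / (2 * τ) + σ * τ * ‖K‖ ^ 2 * (‖w‖ ^ 2 / (2 * σ)) := by
  refine ((neg_le_abs _).trans (abs_inner_apply_le K u w)).trans ?_
  rw [← sub_nonneg]
  have h : ‖u‖ ^ 2 / (2 * τ) + σ * τ * ‖K‖ ^ 2 * (‖w‖ ^ 2 / (2 * σ)) - ‖K‖ * ‖u‖ * ‖w‖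
      = (‖u‖ - τ * ‖K‖ * ‖w‖) ^ 2 / (2 * τ) := by
    field_simp
    ring
  rw [h]
  positivity

lemma inner_sub_sub_eq_norm_sq {E : Type*} [NormedAddCommGroup E] [InnerProductSpace ℝ E]
    (a b c : E) :
    inner ℝ (a - b) (b - c) = (‖a - c‖ ^ 2 - ‖b - c‖ ^ 2 - ‖b - a‖ ^ 2) / 2 := by
  have h : a - c = (a - b) + (b - c) := by abel
  rw [h, norm_add_sq_real, norm_sub_rev b a]
  ring

/-- The Lyapunov function of the primal-dual algorithm. -/
noncomputable def energy (K : X →L[ℝ] Y) (σ τ : ℝ) (u x : X) (y : Y) (x₀ : X) (y₀ : Y) : ℝ :=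
  ‖x - x₀‖ ^ 2 / (2 * τ) + ‖y - y₀‖ ^ 2 / (2 * σ) + inner ℝ (K u) (y - y₀) + ‖u‖ ^ 2 / (2 * τ)

lemma le_energy {σ τ : ℝ} (hσ : 0 < σ) (hτ : 0 < τ) (u x : X) (y : Y) (x₀ : X) (y₀ : Y) :
    ‖x - x₀‖ ^ 2 / (2 * τ) + (1 - σ * τ * ‖K‖ ^ 2) * (‖y - y₀‖ ^ 2 / (2 * σ))
      ≤ energy K σ τ u x y x₀ y₀ := by
  have := neg_inner_apply_le (K := K) hσ hτ u (y - y₀)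
  rw [energy]
  linarith

lemma energy_nonneg {σ τ : ℝ} (hσ : 0 < σ) (hτ : 0 < τ) (hK : σ * τ * ‖K‖ ^ 2 < 1)
    (u x : X) (y : Y) (x₀ : X) (y₀ : Y) : 0 ≤ energy K σ τ u x y x₀ y₀ := by
  refine le_trans ?_ (le_energy hσ hτ u x y x₀ y₀)
  have hk : 0 < 1 - σ * τ * ‖K‖ ^ 2 := by linarith
  positivity

lemma tendsto_of_norm_sq_le {E : Type*} [NormedAddCommGroup E] {z : ℕ → E} {z₀ : E} {c : ℝ}
    {e : ℕ → ℝ} (he : Tendsto e atTop (𝓝 0)) (h : ∀ n, ‖z n - z₀‖ ^ 2 ≤ c * e n) :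
    Tendsto z atTop (𝓝 z₀) := by
  rw [tendsto_iff_norm_sub_tendsto_zero]
  have h₁ : Tendsto (fun n => ‖z n - z₀‖ ^ 2) atTop (𝓝 0) :=
    squeeze_zero (fun n => by positivity) h (by simpa using he.const_mul c)
  simpa using h₁.sqrt

variable [CompleteSpace X] [CompleteSpace Y]

/-- Both monotonicity inequalities are added. With `u` the previous extrapolation, the coupling
terms telescope up to `⟨K u, y' - y⟩`, which the squares of `u` and `y' - y` absorb. -/
lemma energy_step {σ τ s : ℝ} (hσ : 0 < σ) (hτ : 0 < τ) (hs : 0 < s)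
    (hK : σ * τ * ‖K‖ ^ 2 ≤ s ^ 2) {x₀ x x' u : X} {y₀ y y' : Y} (h₀ : IsSaddle f g K x₀ y₀)
    (hy : σ⁻¹ • (y + σ • K (x + u) - y') ∈ subdiff (conj g) y')
    (hx : τ⁻¹ • (x - τ • ContinuousLinearMap.adjoint K y' - x') ∈ subdiff f x') :
    energy K σ τ (x' - x) x' y' x₀ y₀
      + (1 - s) * (‖u‖ ^ 2 / (2 * τ) + ‖y' - y‖ ^ 2 / (2 * σ)) ≤ energy K σ τ u x y x₀ y₀ := by
  have h₁ := subdiff_monotone hx h₀.1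
  have h₂ := subdiff_monotone hy (mem_subdiff_conj_of_mem_subdiff h₀.2)
  have e₁ : τ⁻¹ • (x - τ • ContinuousLinearMap.adjoint K y' - x')
      - -(ContinuousLinearMap.adjoint K y₀)
      = τ⁻¹ • (x - x') - ContinuousLinearMap.adjoint K (y' - y₀) := by
    rw [map_sub, sub_right_comm, smul_sub, smul_smul, inv_mul_cancel₀ hτ.ne', one_smul]
    abel
  have e₂ : σ⁻¹ • (y + σ • K (x + u) - y') - K x₀ = σ⁻¹ • (y - y') + K (x + u - x₀) := by
    rw [add_sub_right_comm, smul_add, smul_smul, inv_mul_cancel₀ hσ.ne', one_smul, map_sub]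
    abel
  rw [e₁, inner_sub_left, real_inner_smul_left, inner_sub_sub_eq_norm_sq,
    ContinuousLinearMap.adjoint_inner_left, real_inner_comm] at h₁
  rw [e₂, inner_add_left, real_inner_smul_left, inner_sub_sub_eq_norm_sq] at h₂
  have e₃ : inner ℝ (K (x + u - x₀)) (y' - y₀) - inner ℝ (K (x' - x₀)) (y' - y₀)
      = inner ℝ (K u) (y - y₀) + inner ℝ (K u) (y' - y) - inner ℝ (K (x' - x)) (y' - y₀) := by
    simp only [map_add, map_sub, inner_add_left, inner_sub_left, inner_sub_right]
    ring
  have h₃ := inner_apply_le_of_le_sq hσ hτ hs hK u (y' - y)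
  have e₄ : ∀ A B C : ℝ, τ⁻¹ * ((A - B - C) / 2) = A / (2 * τ) - B / (2 * τ) - C / (2 * τ) := by
    intro A B C
    ring
  have e₅ : ∀ A B C : ℝ, σ⁻¹ * ((A - B - C) / 2) = A / (2 * σ) - B / (2 * σ) - C / (2 * σ) := by
    intro A B C
    ring
  rw [e₄] at h₁
  rw [e₅] at h₂
  rw [energy, energy]
  linarith

namespace IsPrimalDualSeq

variable {σ τ : ℝ} {x xbar : ℕ → X} {y : ℕ → Y}

lemma mem_subdiff_conj (h : IsPrimalDualSeq f g K σ τ x xbar y) (hg : ProperConvexLsc (conj g))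
    (n : ℕ) : σ⁻¹ • (y n + σ • K (xbar n) - y (n + 1)) ∈ subdiff (conj g) (y (n + 1)) :=
  (h.step_y n).mem_subdiff hg

lemma mem_subdiff (h : IsPrimalDualSeq f g K σ τ x xbar y) (hf : ProperConvexLsc f) (n : ℕ) :
    τ⁻¹ • (x n - τ • ContinuousLinearMap.adjoint K (y (n + 1)) - x (n + 1))
      ∈ subdiff f (x (n + 1)) :=
  (h.step_x n).mem_subdiff hf

lemma xbar_sub (h : IsPrimalDualSeq f g K σ τ x xbar y) (n : ℕ) :
    xbar (n + 1) - x (n + 1) = x (n + 1) - x n := by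
  rw [h.step_xbar]
  module

lemma energy_succ_le (h : IsPrimalDualSeq f g K σ τ x xbar y) (hf : ProperConvexLsc f)
    (hg : ProperConvexLsc (conj g)) {s : ℝ} (hσ : 0 < σ) (hτ : 0 < τ) (hs : 0 < s)
    (hK : σ * τ * ‖K‖ ^ 2 ≤ s ^ 2) {x₀ : X} {y₀ : Y} (h₀ : IsSaddle f g K x₀ y₀) (n : ℕ) :
    energy K σ τ (xbar (n + 1) - x (n + 1)) (x (n + 1)) (y (n + 1)) x₀ y₀
      + (1 - s) * (‖xbar n - x n‖ ^ 2 / (2 * τ) + ‖y (n + 1) - y n‖ ^ 2 / (2 * σ))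
      ≤ energy K σ τ (xbar n - x n) (x n) (y n) x₀ y₀ := by
  rw [h.xbar_sub]
  refine energy_step hσ hτ hs hK h₀ ?_ (h.mem_subdiff hf n)
  rw [add_sub_cancel]
  exact h.mem_subdiff_conj hg n

lemma energy_antitone (h : IsPrimalDualSeq f g K σ τ x xbar y) (hf : ProperConvexLsc f)
    (hg : ProperConvexLsc (conj g)) (hσ : 0 < σ) (hτ : 0 < τ) (hK : σ * τ * ‖K‖ ^ 2 < 1)
    {x₀ : X} {y₀ : Y} (h₀ : IsSaddle f g K x₀ y₀) :
    Antitone fun n => energy K σ τ (xbar n - x n) (x n) (y n) x₀ y₀ :=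
  antitone_nat_of_succ_le fun n => by
    have := h.energy_succ_le hf hg hσ hτ one_pos (by rw [one_pow]; exact hK.le) h₀ n
    simpa using this

lemma norm_sq_le (h : IsPrimalDualSeq f g K σ τ x xbar y) (hf : ProperConvexLsc f)
    (hg : ProperConvexLsc (conj g)) (hσ : 0 < σ) (hτ : 0 < τ) (hK : σ * τ * ‖K‖ ^ 2 < 1)
    {x₀ : X} {y₀ : Y} (h₀ : IsSaddle f g K x₀ y₀) (n : ℕ) :
    ‖x n - x₀‖ ^ 2 / (2 * τ) + (1 - σ * τ * ‖K‖ ^ 2) * (‖y n - y₀‖ ^ 2 / (2 * σ)) ≤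
      ‖x 0 - x₀‖ ^ 2 / (2 * τ) + ‖y 0 - y₀‖ ^ 2 / (2 * σ) := by
  refine (le_energy hσ hτ _ _ _ _ _).trans
    ((h.energy_antitone hf hg hσ hτ hK h₀ n.zero_le).trans_eq ?_)
  -- Since `xbar 0 = x 0`, the initial energy has no coupling term.
  simp [energy, h.init]

lemma isBounded_range (h : IsPrimalDualSeq f g K σ τ x xbar y) (hf : ProperConvexLsc f)
    (hg : ProperConvexLsc (conj g)) (hσ : 0 < σ) (hτ : 0 < τ) (hK : σ * τ * ‖K‖ ^ 2 < 1)
    {x₀ : X} {y₀ : Y} (h₀ : IsSaddle f g K x₀ y₀) :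
    Bornology.IsBounded (Set.range fun n => (x n, y n)) := by
  set C := ‖x 0 - x₀‖ ^ 2 / (2 * τ) + ‖y 0 - y₀‖ ^ 2 / (2 * σ)
  have hk : 0 < 1 - σ * τ * ‖K‖ ^ 2 := by linarith
  have hb := h.norm_sq_le hf hg hσ hτ hK h₀
  have hx : ∀ n, x n ∈ Metric.closedBall x₀ (√(C * (2 * τ))) := fun n => by
    rw [mem_closedBall_iff_norm]
    refine Real.le_sqrt_of_sq_le ?_
    rw [← div_le_iff₀ (by positivity)]
    have : 0 ≤ (1 - σ * τ * ‖K‖ ^ 2) * (‖y n - y₀‖ ^ 2 / (2 * σ)) := by positivity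
    linarith [hb n]
  have hy : ∀ n, y n ∈ Metric.closedBall y₀ (√(C / (1 - σ * τ * ‖K‖ ^ 2) * (2 * σ))) := fun n => by
    rw [mem_closedBall_iff_norm]
    refine Real.le_sqrt_of_sq_le ?_
    rw [← div_le_iff₀ (by positivity), le_div_iff₀ hk]
    have : 0 ≤ ‖x n - x₀‖ ^ 2 / (2 * τ) := by positivity
    linarith [hb n]
  refine ((Metric.isBounded_closedBall (x := x₀)).prod
    (Metric.isBounded_closedBall (x := y₀))).subset (Set.range_subset_iff.2 fun n => ⟨hx n, hy n⟩)

/-- The increments of the primal-dual iterates tend to zero. -/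
lemma tendsto_increments (h : IsPrimalDualSeq f g K σ τ x xbar y) (hf : ProperConvexLsc f)
    (hg : ProperConvexLsc (conj g)) (hσ : 0 < σ) (hτ : 0 < τ) (hK : σ * τ * ‖K‖ ^ 2 < 1)
    {x₀ : X} {y₀ : Y} (h₀ : IsSaddle f g K x₀ y₀) :
    Tendsto (fun n => xbar n - x n) atTop (𝓝 0) ∧
      Tendsto (fun n => y (n + 1) - y n) atTop (𝓝 0) := by
  set e : ℕ → ℝ := fun n => energy K σ τ (xbar n - x n) (x n) (y n) x₀ y₀
  have hlim := tendsto_atTop_ciInf (h.energy_antitone hf hg hσ hτ hK h₀)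
    ⟨0, by rintro _ ⟨n, rfl⟩; exact energy_nonneg hσ hτ hK _ _ _ _ _⟩
  have hdiff : Tendsto (fun n => e n - e (n + 1)) atTop (𝓝 0) := by
    simpa using hlim.sub ((tendsto_add_atTop_iff_nat 1).2 hlim)
  set k := σ * τ * ‖K‖ ^ 2
  have hk0 : 0 ≤ k := by positivity
  -- By AM–GM, `s = (1 + k) / 2` satisfies `k ≤ s²`, and `k < 1` gives `s < 1`.
  have hs : k ≤ ((1 + k) / 2) ^ 2 := by nlinarith [sq_nonneg (1 - k)]
  have hstep := h.energy_succ_le hf hg hσ hτ (by linarith) hs h₀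
  have hk : 0 < 1 - (1 + k) / 2 := by linarith
  have hbound : ∀ n, ‖xbar n - x n‖ ^ 2 / (2 * τ) + ‖y (n + 1) - y n‖ ^ 2 / (2 * σ)
      ≤ (1 - (1 + k) / 2)⁻¹ * (e n - e (n + 1)) := fun n => by
    rw [le_inv_mul_iff₀ hk]
    linarith [hstep n]
  constructor
  · refine tendsto_of_norm_sq_le (c := 2 * τ * (1 - (1 + k) / 2)⁻¹) hdiff fun n => ?_
    rw [sub_zero, mul_assoc, ← div_le_iff₀' (by positivity)]
    have : 0 ≤ ‖y (n + 1) - y n‖ ^ 2 / (2 * σ) := by positivity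
    linarith [hbound n]
  · refine tendsto_of_norm_sq_le (c := 2 * σ * (1 - (1 + k) / 2)⁻¹) hdiff fun n => ?_
    rw [sub_zero, mul_assoc, ← div_le_iff₀' (by positivity)]
    have : 0 ≤ ‖xbar n - x n‖ ^ 2 / (2 * τ) := by positivity
    linarith [hbound n]

/-- Cluster points of the iterates satisfy the optimality conditions. -/
lemma isSaddle_of_tendsto_subseq (h : IsPrimalDualSeq f g K σ τ x xbar y)
    (hf : ProperConvexLsc f) (hg : ProperConvexLsc g) (hg' : ProperConvexLsc (conj g))
    (hσ : 0 < σ) (hτ : 0 < τ) (hu : Tendsto (fun n => xbar n - x n) atTop (𝓝 0))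
    (hw : Tendsto (fun n => y (n + 1) - y n) atTop (𝓝 0)) {φ : ℕ → ℕ} (hφ : StrictMono φ)
    {x₁ : X} {y₁ : Y} (hx : Tendsto (x ∘ φ) atTop (𝓝 x₁)) (hy : Tendsto (y ∘ φ) atTop (𝓝 y₁)) :
    IsSaddle f g K x₁ y₁ := by
  have hu₀ : Tendsto (fun n => xbar (φ n) - x (φ n)) atTop (𝓝 0) := hu.comp hφ.tendsto_atTop
  have hu₁ : Tendsto (fun n => x (φ n + 1) - x (φ n)) atTop (𝓝 0) := by
    have := ((tendsto_add_atTop_iff_nat 1).2 hu).comp hφ.tendsto_atTop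
    simpa only [Function.comp_def, h.xbar_sub] using this
  have hw₁ : Tendsto (fun n => y (φ n + 1) - y (φ n)) atTop (𝓝 0) := hw.comp hφ.tendsto_atTop
  -- The inclusions hold at index `φ n + 1`; vanishing increments give the shifted subsequence the
  -- same limit.
  have hx₁ : Tendsto (fun n => x (φ n + 1)) atTop (𝓝 x₁) := by
    simpa using hx.add hu₁
  have hy₁ : Tendsto (fun n => y (φ n + 1)) atTop (𝓝 y₁) := by
    simpa using hy.add hw₁
  have hxbar : Tendsto (fun n => xbar (φ n)) atTop (𝓝 x₁) := by
    simpa using hx.add hu₀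
  constructor
  · refine mem_subdiff_of_tendsto hf hx₁ ?_ fun n => h.mem_subdiff hf (φ n)
    have hlim : Tendsto (fun n => -(τ⁻¹ • (x (φ n + 1) - x (φ n)))
        - ContinuousLinearMap.adjoint K (y (φ n + 1))) atTop
        (𝓝 (-(τ⁻¹ • (0 : X)) - ContinuousLinearMap.adjoint K y₁)) :=
      (hu₁.const_smul _).neg.sub
        (((ContinuousLinearMap.adjoint K).continuous.tendsto _).comp hy₁)
    rw [smul_zero, neg_zero, zero_sub] at hlim
    refine hlim.congr fun n => ?_
    rw [sub_right_comm, smul_sub τ⁻¹ (x (φ n) - x (φ n + 1)), smul_smul,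
      inv_mul_cancel₀ hτ.ne', one_smul, ← smul_neg, neg_sub]
  · refine mem_subdiff_of_mem_subdiff_conj hg
      (mem_subdiff_of_tendsto hg' hy₁ ?_ fun n => h.mem_subdiff_conj hg' (φ n))
    have hlim : Tendsto (fun n => -(σ⁻¹ • (y (φ n + 1) - y (φ n))) + K (xbar (φ n))) atTop
        (𝓝 (-(σ⁻¹ • (0 : Y)) + K x₁)) :=
      (hw₁.const_smul _).neg.add ((K.continuous.tendsto _).comp hxbar)
    rw [smul_zero, neg_zero, zero_add] at hlim
    refine hlim.congr fun n => ?_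
    rw [add_sub_right_comm, smul_add, smul_smul, inv_mul_cancel₀ hσ.ne', one_smul, ← smul_neg,
      neg_sub]

/-- In finite dimensions the iterates converge to a point that satisfies the optimality
conditions. -/
lemma exists_tendsto [FiniteDimensional ℝ X] [FiniteDimensional ℝ Y]
    (h : IsPrimalDualSeq f g K σ τ x xbar y)
    (hf : ProperConvexLsc f) (hg : ProperConvexLsc g) (hg' : ProperConvexLsc (conj g))
    (hσ : 0 < σ) (hτ : 0 < τ) (hK : σ * τ * ‖K‖ ^ 2 < 1)
    {x₀ : X} {y₀ : Y} (h₀ : IsSaddle f g K x₀ y₀) :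
    ∃ x₁ y₁, IsSaddle f g K x₁ y₁ ∧ Tendsto x atTop (𝓝 x₁) ∧ Tendsto y atTop (𝓝 y₁) := by
  have : ProperSpace X := FiniteDimensional.proper_real X
  have : ProperSpace Y := FiniteDimensional.proper_real Y
  obtain ⟨⟨x₁, y₁⟩, -, φ, hφ, hlim⟩ := tendsto_subseq_of_bounded
    (h.isBounded_range hf hg' hσ hτ hK h₀) (x := fun n => (x n, y n)) fun n => ⟨n, rfl⟩
  have hx : Tendsto (x ∘ φ) atTop (𝓝 x₁) := (continuous_fst.tendsto _).comp hlim
  have hy : Tendsto (y ∘ φ) atTop (𝓝 y₁) := (continuous_snd.tendsto _).comp hlim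
  obtain ⟨hu, hw⟩ := h.tendsto_increments hf hg' hσ hτ hK h₀
  have h₁ := h.isSaddle_of_tendsto_subseq hf hg hg' hσ hτ hu hw hφ hx hy
  -- The energy is recentred at the cluster point, now known to be a saddle point; being monotone,
  -- it inherits the limit `0` of its subsequence.
  set e : ℕ → ℝ := fun n => energy K σ τ (xbar n - x n) (x n) (y n) x₁ y₁
  have hmono := tendsto_atTop_ciInf (h.energy_antitone hf hg' hσ hτ hK h₁)
    ⟨0, by rintro _ ⟨n, rfl⟩; exact energy_nonneg hσ hτ hK _ _ _ _ _⟩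
  have hsub : Tendsto (e ∘ φ) atTop (𝓝 0) := by
    have hcont : Continuous fun q : X × X × Y => energy K σ τ q.1 q.2.1 q.2.2 x₁ y₁ := by
      unfold energy
      fun_prop
    have := (hcont.tendsto (0, x₁, y₁)).comp
      ((hu.comp hφ.tendsto_atTop).prodMk_nhds (hx.prodMk_nhds hy))
    have h0 : energy K σ τ 0 x₁ y₁ x₁ y₁ = 0 := by simp [energy]
    rwa [h0] at this
  have he : Tendsto e atTop (𝓝 0) := by
    rwa [tendsto_nhds_unique (hmono.comp hφ.tendsto_atTop) hsub] at hmono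
  have hk : 0 < 1 - σ * τ * ‖K‖ ^ 2 := by linarith
  refine ⟨x₁, y₁, h₁, tendsto_of_norm_sq_le (c := 2 * τ) he fun n => ?_,
    tendsto_of_norm_sq_le (c := 2 * σ * (1 - σ * τ * ‖K‖ ^ 2)⁻¹) he fun n => ?_⟩
  · rw [← div_le_iff₀' (by positivity)]
    refine le_trans ?_ (le_energy hσ hτ (xbar n - x n) (x n) (y n) x₁ y₁)
    exact le_add_of_nonneg_right (by positivity)
  · rw [mul_assoc, ← div_le_iff₀' (by positivity), le_inv_mul_iff₀ hk]
    refine le_trans ?_ (le_energy hσ hτ (xbar n - x n) (x n) (y n) x₁ y₁)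
    exact le_add_of_nonneg_left (by positivity)

end IsPrimalDualSeq

end Algorithm
end ConvexDuality

open ConvexDuality Filter Topology in
theorem theorem15 {X Y : Type*}
    [NormedAddCommGroup X] [InnerProductSpace ℝ X] [CompleteSpace X]
    [NormedAddCommGroup Y] [InnerProductSpace ℝ Y] [CompleteSpace Y]
    (f : X → EReal) (g : Y → EReal) (K : X →L[ℝ] Y)
    (hf : ProperConvexLsc f) (hg : ProperConvexLsc g)
    (xhat : X) (hxhat : IsPrimalOptimal f g K xhat)
    (hQC : QC1 f g K ∨ QC2 f g K ∨ QC3 f g K) :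
    -- (i)
    (∃ yhat : Y, IsDualOptimal f g K yhat ∧
      (⨅ x : X, primalObj f g K x) = (⨆ y : Y, dualObj f g K y) ∧
      K xhat ∈ subdiff (conj g) yhat ∧
      -(ContinuousLinearMap.adjoint K yhat) ∈ subdiff f xhat) ∧
    ∀ σ τ : ℝ, 0 < σ → 0 < τ → σ * τ * ‖K‖ ^ 2 < 1 →
      ∀ (x xbar : ℕ → X) (y : ℕ → Y), IsPrimalDualSeq f g K σ τ x xbar y →
        -- (ii)
        ((∀ yhat : Y, IsDualOptimal f g K yhat → ∀ n : ℕ,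
            ‖x n - xhat‖ ^ 2 / (2 * τ) +
                (1 - σ * τ * ‖K‖ ^ 2) * (‖y n - yhat‖ ^ 2 / (2 * σ)) ≤
              ‖x 0 - xhat‖ ^ 2 / (2 * τ) + ‖y 0 - yhat‖ ^ 2 / (2 * σ)) ∧
          Bornology.IsBounded (Set.range fun n => (x n, y n))) ∧
        -- (iii)
        (FiniteDimensional ℝ X → FiniteDimensional ℝ Y →
          (∃ xstar : X, IsPrimalOptimal f g K xstar ∧ Tendsto x atTop (𝓝 xstar)) ∧
          (∃ ystar : Y, IsDualOptimal f g K ystar ∧ Tendsto y atTop (𝓝 ystar))) := by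
  have hQC3 : QC3 f g K := by
    rcases hQC with h | h | h
    · exact QC3_of_QC2 (QC2_of_QC1 h)
    · exact QC3_of_QC2 h
    · exact h
  obtain ⟨y₀, h₀⟩ := exists_isSaddle hf hg hQC3 hxhat
  obtain ⟨-, d, -, hd, -⟩ := mem_subdiff_iff_fenchel.1 h₀.2
  have hg' : ProperConvexLsc (conj g) :=
    properConvexLsc_conj hg (hd.trans_lt (EReal.coe_lt_top d))
  refine ⟨⟨y₀, h₀.isDualOptimal hf hg, h₀.iInf_eq_iSup hf hg,
    mem_subdiff_conj_of_mem_subdiff h₀.2, h₀.1⟩, ?_⟩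
  intro σ τ hσ hτ hK x xbar y h
  refine ⟨⟨fun yhat hy n => h.norm_sq_le hf hg' hσ hτ hK (h₀.of_isDualOptimal hf hg hy) n,
    h.isBounded_range hf hg' hσ hτ hK h₀⟩, ?_⟩
  intro _ _
  obtain ⟨x₁, y₁, h₁, hx, hy⟩ := h.exists_tendsto hf hg hg' hσ hτ hK h₀
  exact ⟨⟨x₁, h₁.isPrimalOptimal hf hg, hx⟩, ⟨y₁, h₁.isDualOptimal hf hg, hy⟩⟩
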